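/- Let $K$ be a field of characteristic zero and let $R=K[x,y,z]$ be the polynomial ring with its standard grading. Let $a,b,c,\alpha,\beta,\gamma$ be integers with $1\le\alpha\le a-1$, $1\le\beta\le b-1$, $1\le\gamma\le c-1$ and $\alpha+\gamma=b$. Put $$\mathfrak a=(x^a,\;y^b-x^\alpha z^\gamma,\;z^c),\qquad I=(x^a,\;y^b-x^\alpha z^\gamma,\;z^c,\;x^{a-\alpha}y^{b-\beta},\;y^{b-\beta}z^{c-\gamma}).$$ (i) $I=\mathfrak a:_R y^\beta$. Moreover, $R/I$ is a graded Artinian Gorenstein algebra (that is, with $D$ its socle degree, the last degree in which $R/I$ is nonzero, $\dim_K[R/I]_D=1$ and the multiplication maps $[R/I]_i\times[R/I]_{D-i}\to[R/I]_D\cong K$ are perfect pairings for $0\le i\le D$). It has codimension $3$ (both in the sense that $I$ has height $3$ and that $\dim_K[R/I]_1=3$), and its socle degree is $D=a+b+c-\beta-3$. (ii) Let $\circ$ be the contraction action of $R$ on itself, i.e. the $K$-bilinear map such that, for monomials, $x^{u_1}y^{u_2}z^{u_3}\circ x^{v_1}y^{v_2}z^{v_3}=x^{v_1-u_1}y^{v_2-u_2}z^{v_3-u_3}$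 if $u_k\le v_k$ for $k=1,2,3$, and $0$ otherwise. Let $m=\max\{j\ge 0\mid a-1-j\alpha\ge0\text{ and }c-1-j\gamma\ge0\}$ and $$F=\sum_{i=0}^m x^{a-1-i\alpha}\,y^{(i+1)b-1-\beta}\,z^{c-1-i\gamma}.$$ Then $F$ is a Macaulay dual generator of $R/I$, i.e. $I=\{f\in R\mid f\circ F=0\}$. (iii) The minimal graded free resolution of $R/I$ is $$0\to R(-a-b-c+\beta)\xrightarrow{\,p^{t}\,}F_2\xrightarrow{\,M\,}F_1\xrightarrow{\,p\,}R\to R/I\to0,$$ where $$F_2=R(-a-b+\beta)\oplus R(-b-c+\beta)\oplus R(-a-\gamma)\oplus R(-c-\alpha)\oplus R(-a-c+\beta),$$ $$F_1=R(-c)\oplus R(-a)\oplus R(-c-\alpha+\beta)\oplus R(-a-\gamma+\beta)\oplus R(-b),$$ $$p=\begin{pmatrix}z^c& x^a& y^{b-\beta}z^{c-\gamma}& x^{a-\alpha}y^{b-\beta}& y^b-x^\alpha z^\gamma\end{pmatrix},$$ and $M$ is the skew-symmetric matrix $$M=\begin{pmatrix}0&y^{b-\beta}&0&-x^\alpha&0\\-y^{b-\beta}&0&z^\gamma&0&0\\0&-z^\gamma&0&y^\beta&-x^{a-\alpha}\\x^\alpha&0&-y^\beta&0&z^{c-\gamma}\\0&0&x^{a-\alpha}&-z^{c-\gamma}&0\end{pmatrix}.$$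 That is, with matrices acting on column vectors, the sequence is exact, all its maps are graded of degree zero, and the image of each of the maps $p^t$, $M$, $p$ lies in $(x,y,z)$ times its target. -/

import Mathlib

open MvPolynomial

noncomputable section

namespace GorensteinCodimThree

section Graded

variable {σ K : Type*} [Field K]

/-- The graded piece `[R/I]_i` of `R/I`, where `R = K[x_s : s ∈ σ]` has its standard grading:
the image in `R/I` of the forms of degree `i`. -/
def gradedPiece (I : Ideal (MvPolynomial σ K)) (i : ℕ) :
    Submodule K (MvPolynomial σ K ⧸ I) :=
  (homogeneousSubmodule σ K i).map (Ideal.Quotient.mkₐ K I).toLinearMap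

/-- The Hilbert function `t ↦ dim_K [R/I]_t`. -/
def hilbertFunction (I : Ideal (MvPolynomial σ K)) (t : ℕ) : ℕ :=
  Module.finrank K (gradedPiece I t)

lemma mul_mem_gradedPiece (I : Ideal (MvPolynomial σ K)) {i j k : ℕ} (h : i + j = k)
    {u v : MvPolynomial σ K ⧸ I} (hu : u ∈ gradedPiece I i) (hv : v ∈ gradedPiece I j) :
    u * v ∈ gradedPiece I k := by
  obtain ⟨f, hf, rfl⟩ := hu
  obtain ⟨g, hg, rfl⟩ := hv
  refine ⟨f * g, ?_, by simp⟩
  subst h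
  exact IsHomogeneous.mul hf hg

/-- The multiplication map `[R/I]_i × [R/I]_j → [R/I]_k` for `i + j = k`. -/
def gradedMul (I : Ideal (MvPolynomial σ K)) {i j k : ℕ} (h : i + j = k) :
    gradedPiece I i →ₗ[K] gradedPiece I j →ₗ[K] gradedPiece I k :=
  LinearMap.mk₂ K (fun u v => ⟨u.1 * v.1, mul_mem_gradedPiece I h u.2 v.2⟩)
    (fun u u' v => Subtype.ext (add_mul u.1 u'.1 v.1))
    (fun r u v => Subtype.ext (smul_mul_assoc r u.1 v.1))
    (fun u v v' => Subtype.ext (mul_add u.1 v.1 v'.1))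
    (fun r u v => Subtype.ext (mul_smul_comm r u.1 v.1))

/-- `R/I` is a standard graded Artinian algebra: `I` is a homogeneous ideal (it contains the
homogeneous components of each of its elements) and `R/I` is an Artinian ring. -/
structure IsGradedArtinian (I : Ideal (MvPolynomial σ K)) : Prop where
  homogeneous : ∀ f ∈ I, ∀ i : ℕ, homogeneousComponent i f ∈ I
  artinian : IsArtinianRing (MvPolynomial σ K ⧸ I)

/-- The socle degree of `R/I` is `D`: the last degree in which the Hilbert function is positive. -/
def HasSocleDegree (I : Ideal (MvPolynomial σ K)) (D : ℕ) : Prop :=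
  IsGreatest {t : ℕ | 0 < hilbertFunction I t} D

/-- `R/I` is a standard graded Artinian Gorenstein algebra: in its socle degree `D` one has
`dim_K [R/I]_D = 1`, and, after an identification `[R/I]_D ≅ K`, every multiplication map
`[R/I]_i × [R/I]_{D-i} → [R/I]_D ≅ K` is a perfect pairing. -/
def IsArtinianGorenstein (I : Ideal (MvPolynomial σ K)) : Prop :=
  IsGradedArtinian I ∧
    ∃ D : ℕ, HasSocleDegree I D ∧ hilbertFunction I D = 1 ∧
      ∃ e : gradedPiece I D ≃ₗ[K] K,
        ∀ (i j : ℕ) (h : i + j = D),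
          ((gradedMul I h).compr₂ e.toLinearMap).IsPerfPair

open Classical in
/-- The contraction action `f ∘ g` of `R` on itself: the `K`-bilinear extension of
`x^u ∘ x^v = x^(v-u)` if `u ≤ v` componentwise, and `0` otherwise. -/
def contract (f g : MvPolynomial σ K) : MvPolynomial σ K :=
  ∑ u ∈ f.support, ∑ v ∈ g.support,
    if u ≤ v then monomial (v - u) (coeff u f * coeff v g) else 0

/-- `F` is a Macaulay dual generator of `R/I`: `I` is the annihilator of `F` for contraction. -/
def IsMacaulayDualGenerator (I : Ideal (MvPolynomial σ K)) (F : MvPolynomial σ K) : Prop :=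
  (I : Set (MvPolynomial σ K)) = {f | contract f F = 0}

/-- The vector `v`, as an element of the graded free module `⨁_i R(-d i)`, is homogeneous of
degree `t`: its `i`-th coordinate is a form of degree `t - d i` (zero if `t < d i`). -/
def IsTwistedHomogeneous {ι : Type*} (d : ι → ℤ) (t : ℤ) (v : ι → MvPolynomial σ K) : Prop :=
  ∀ i, ∀ s ∈ (v i).support, (s.degree : ℤ) + d i = t

/-- The matrix `A` defines a homomorphism `⨁_j R(-d j) → ⨁_i R(-e i)` (acting on column vectors)
which is graded of degree zero, and which is minimal: its image lies in `𝔪 (⨁_i R(-e i))`, with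
`𝔪` the ideal generated by the variables. -/
structure IsMinimalGradedMap {ι κ : Type*} [Fintype ι] (d : ι → ℤ) (e : κ → ℤ)
    (A : Matrix κ ι (MvPolynomial σ K)) : Prop where
  graded : ∀ (t : ℤ) (v : ι → MvPolynomial σ K),
    IsTwistedHomogeneous d t v → IsTwistedHomogeneous e t (A.mulVec v)
  minimal : ∀ (v : ι → MvPolynomial σ K) (i : κ),
    A.mulVec v i ∈ Ideal.span (Set.range (X : σ → MvPolynomial σ K))

/-- The matrices `A₁`, `A₂`, `A₃` define a minimal graded free resolution
`0 → ⨁ R(-d₃ k) → ⨁ R(-d₂ j) → ⨁ R(-d₁ i) → R → R/I → 0`. -/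
structure IsMinimalGradedFreeResolution {ι₁ ι₂ ι₃ : Type*}
    [Fintype ι₁] [Fintype ι₂] [Fintype ι₃]
    (I : Ideal (MvPolynomial σ K)) (d₁ : ι₁ → ℤ) (d₂ : ι₂ → ℤ) (d₃ : ι₃ → ℤ)
    (A₁ : Matrix (Fin 1) ι₁ (MvPolynomial σ K)) (A₂ : Matrix ι₁ ι₂ (MvPolynomial σ K))
    (A₃ : Matrix ι₂ ι₃ (MvPolynomial σ K)) : Prop where
  map₁ : IsMinimalGradedMap d₁ (fun _ : Fin 1 => (0 : ℤ)) A₁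
  map₂ : IsMinimalGradedMap d₂ d₁ A₂
  map₃ : IsMinimalGradedMap d₃ d₂ A₃
  exact₀ : Function.Exact A₁.mulVecLin (I.mkQ.comp (LinearMap.proj (0 : Fin 1)))
  exact₁ : Function.Exact A₂.mulVecLin A₁.mulVecLin
  exact₂ : Function.Exact A₃.mulVecLin A₂.mulVecLin
  injective : Function.Injective A₃.mulVecLin

end Graded

section Family

variable (K : Type*) [Field K] (a b c α β γ : ℕ)

/-- The complete intersection `(x^a, y^b - x^α z^γ, z^c)` in `K[x,y,z]`,
with `x = X 0`, `y = X 1`, `z = X 2`. -/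
def completeIntersection : Ideal (MvPolynomial (Fin 3) K) :=
  Ideal.span {X 0 ^ a, X 1 ^ b - X 0 ^ α * X 2 ^ γ, X 2 ^ c}

/-- The ideal `(x^a, y^b - x^α z^γ, z^c, x^(a-α) y^(b-β), y^(b-β) z^(c-γ))` in `K[x,y,z]`. -/
def gorensteinIdeal : Ideal (MvPolynomial (Fin 3) K) :=
  Ideal.span {X 0 ^ a, X 1 ^ b - X 0 ^ α * X 2 ^ γ, X 2 ^ c,
    X 0 ^ (a - α) * X 1 ^ (b - β), X 1 ^ (b - β) * X 2 ^ (c - γ)}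

/-- The polynomial `∑_{i=0}^m x^(a-1-iα) y^((i+1)b-1-β) z^(c-1-iγ)`. -/
def dualGenerator (m : ℕ) : MvPolynomial (Fin 3) K :=
  ∑ i ∈ Finset.range (m + 1),
    X 0 ^ (a - 1 - i * α) * X 1 ^ ((i + 1) * b - 1 - β) * X 2 ^ (c - 1 - i * γ)

/-- The row of the five generators, in the order that matches `skewMatrix`. -/
def generatorRow : Matrix (Fin 1) (Fin 5) (MvPolynomial (Fin 3) K) :=
  !![X 2 ^ c, X 0 ^ a, X 1 ^ (b - β) * X 2 ^ (c - γ), X 0 ^ (a - α) * X 1 ^ (b - β),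
    X 1 ^ b - X 0 ^ α * X 2 ^ γ]

/-- The skew-symmetric matrix of the resolution. -/
def skewMatrix : Matrix (Fin 5) (Fin 5) (MvPolynomial (Fin 3) K) :=
  !![0, X 1 ^ (b - β), 0, -X 0 ^ α, 0;
    -X 1 ^ (b - β), 0, X 2 ^ γ, 0, 0;
    0, -X 2 ^ γ, 0, X 1 ^ β, -X 0 ^ (a - α);
    X 0 ^ α, 0, -X 1 ^ β, 0, X 2 ^ (c - γ);
    0, 0, X 0 ^ (a - α), -X 2 ^ (c - γ), 0]

end Family

end GorensteinCodimThree

end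

/-! Everything in (i) and (ii) comes from one linear functional `L` (`dualFunctional`), equal to 1
on the monomials of `F` and 0 on all others. Since `α + γ = b`, all those monomials have degree `D =
a + b + c - β - 3`. The heart is `gorensteinIdeal_eq_annihilator`: `I` is the set of `f` with `L (h
* f) = 0` for all `h`.

The generators of `I` annihilate `L`: multiplying by `y^b` or by `x^α z^γ` matches consecutive terms
of `F`, and the four monomial generators divide no term. Conversely, rewriting `y^b` as `x^α z^γ`
reduces every polynomial modulo `I` to a combination of standard monomials (`monomial_mem_sup`).
Such a combination, if nonzero, does not annihilate `L`, because each of its monomials is isolated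
by a multiplier landing in the term `i = 0` or `i = 1` of `F` (`eq_zero_of_mem_restrictSupport`).

Consequences: an annihilator of a functional of degree `D` has perfect pairings
(`isArtinianGorenstein_of_functional`); contraction against `F` has the same annihilator as `L`
(`contract_eq_zero_iff`); and `L` is the functional for `β = 0` composed with multiplication by
`y^β`, which gives the colon formula. Forms of degree above `D` lie in `I`, so `I` contains powers
of all the variables and has height 3.

The resolution has the Buchsbaum-Eisenbud shape, but exactness is checked directly: powers of
distinct variables form regular sequences, and `y^b - x^α z^γ` is a nonzerodivisor modulo `(x^(a-α),
z^(c-γ))`, being a nonzerodivisor minus a nilpotent. -/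

namespace GorensteinCodimThree

/-! ### Macaulay duality: annihilators of graded functionals and contraction. -/

section Duality

variable {σ K : Type*} [Field K] {I : Ideal (MvPolynomial σ K)} {D : ℕ}
  {L : MvPolynomial σ K →ₗ[K] K}

lemma degree_eq_of_isHomogeneous {n : ℕ} {f : MvPolynomial σ K} (hf : f.IsHomogeneous n)
    {d : σ →₀ ℕ} (hd : d ∈ f.support) : d.degree = n := by
  rw [Finsupp.degree_eq_weight_one]
  exact hf (mem_support_iff.1 hd)

/-- A linear functional of degree `D` on `K[x_s : s ∈ σ]` only sees the component of `f` that is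
complementary to a form `h`. -/
lemma functional_mul_homogeneousComponent
    (hL : ∀ n, n ≠ D → ∀ g : MvPolynomial σ K, g.IsHomogeneous n → L g = 0)
    {i j : ℕ} (hij : i + j = D) {h : MvPolynomial σ K} (hh : h.IsHomogeneous j)
    (f : MvPolynomial σ K) : L (h * homogeneousComponent i f) = L (h * f) := by
  have hsum : L (h * f) =
      ∑ k ∈ Finset.range (f.totalDegree + 1), L (h * homogeneousComponent k f) := by
    rw [← map_sum, ← Finset.mul_sum, sum_homogeneousComponent]
  rw [hsum, Finset.sum_eq_single i]
  · intro k _ hk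
    exact hL (j + k) (by omega) _ (hh.mul (homogeneousComponent_isHomogeneous k f))
  · intro hi
    rw [homogeneousComponent_eq_zero, mul_zero, map_zero]
    simpa using hi

/-- A form of degree `i` is in the annihilator of a functional of degree `D` as soon as it is
orthogonal to the forms of degree `D - i`. -/
lemma mem_of_isHomogeneous_of_functional
    (hL : ∀ n, n ≠ D → ∀ g : MvPolynomial σ K, g.IsHomogeneous n → L g = 0)
    (hI : ∀ f, f ∈ I ↔ ∀ h, L (h * f) = 0) {i : ℕ} {f : MvPolynomial σ K}
    (hf : f.IsHomogeneous i)
    (hfL : ∀ j, i + j = D → ∀ h : MvPolynomial σ K, h.IsHomogeneous j → L (h * f) = 0) :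
    f ∈ I := by
  refine (hI f).2 fun h => ?_
  rw [← sum_homogeneousComponent h, Finset.sum_mul, map_sum]
  refine Finset.sum_eq_zero fun j _ => ?_
  have hj := homogeneousComponent_isHomogeneous j h
  by_cases hij : i + j = D
  · exact hfL j hij _ hj
  · exact hL (j + i) (by omega) _ (hj.mul hf)

lemma homogeneousComponent_mem_of_functional
    (hL : ∀ n, n ≠ D → ∀ g : MvPolynomial σ K, g.IsHomogeneous n → L g = 0)
    (hI : ∀ f, f ∈ I ↔ ∀ h, L (h * f) = 0) {f : MvPolynomial σ K} (hf : f ∈ I) (i : ℕ) :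
    homogeneousComponent i f ∈ I := by
  refine mem_of_isHomogeneous_of_functional hL hI (homogeneousComponent_isHomogeneous i f)
    fun j hij h hh => ?_
  rw [functional_mul_homogeneousComponent hL hij hh]
  exact (hI f).1 hf h

/-- The functional on `R/I` induced by a functional that vanishes on `I`. -/
noncomputable def quotientFunctional (L : MvPolynomial σ K →ₗ[K] K) (hL : ∀ f ∈ I, L f = 0) :
    (MvPolynomial σ K ⧸ I) →ₗ[K] K :=
  ((I.restrictScalars K).liftQ L (fun f hf => hL f hf)).comp
    (Submodule.Quotient.restrictScalarsEquiv K I).symm.toLinearMap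

/-- If `I` is the annihilator of a functional of degree `D`, and `R/I` is a nonzero
finite-dimensional algebra, then `R/I` is graded Artinian Gorenstein of socle degree `D`. -/
theorem isArtinianGorenstein_of_functional
    (hL : ∀ n, n ≠ D → ∀ g : MvPolynomial σ K, g.IsHomogeneous n → L g = 0)
    (hI : ∀ f, f ∈ I ↔ ∀ h, L (h * f) = 0) (hI1 : (1 : MvPolynomial σ K) ∉ I)
    [FiniteDimensional K (MvPolynomial σ K ⧸ I)] :
    IsArtinianGorenstein I ∧ HasSocleDegree I D := by
  have hLI : ∀ f ∈ I, L f = 0 := fun f hf => by simpa using (hI f).1 hf 1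
  set Q := quotientFunctional L hLI
  have hinj : Function.Injective (Q.domRestrict (gradedPiece I D)) := by
    rw [injective_iff_map_eq_zero]
    rintro ⟨_, f, hf, rfl⟩ h0
    have h0 : L f = 0 := h0
    refine Subtype.ext (Ideal.Quotient.eq_zero_iff_mem.2 ?_)
    refine mem_of_isHomogeneous_of_functional hL hI hf fun j hj h hh => ?_
    -- Only constants are complementary to degree `D`, so injectivity on `[R/I]_D` reduces to `L f =
    -- 0`.
    obtain rfl : j = 0 := by omega
    rw [← totalDegree_zero_iff_isHomogeneous, totalDegree_eq_zero_iff_eq_C] at hh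
    rw [hh, C_mul', map_smul, h0, smul_zero]
  have hsurj : Function.Surjective (Q.domRestrict (gradedPiece I D)) := by
    apply LinearMap.surjective
    intro h0
    -- If `L` vanished on forms of degree `D` it would vanish identically, putting 1 in `I`.
    refine hI1 ((hI 1).2 fun h => ?_)
    rw [mul_one, ← mul_one h, mul_comm,
      ← functional_mul_homogeneousComponent hL (add_zero D) (isHomogeneous_one σ K), one_mul]
    exact LinearMap.congr_fun h0
      ⟨_, homogeneousComponent D h, homogeneousComponent_isHomogeneous D h, rfl⟩
  let e := LinearEquiv.ofBijective (Q.domRestrict (gradedPiece I D)) ⟨hinj, hsurj⟩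
  have hfin : hilbertFunction I D = 1 := by
    rw [hilbertFunction, e.finrank_eq, Module.finrank_self]
  have hsocle : HasSocleDegree I D := by
    refine ⟨by simp [hfin], fun t ht => ?_⟩
    by_contra! hDt
    have hbot : gradedPiece I t = ⊥ := by
      rw [eq_bot_iff]
      rintro _ ⟨f, hf, rfl⟩
      exact Ideal.Quotient.eq_zero_iff_mem.2
        (mem_of_isHomogeneous_of_functional hL hI hf fun j hj => by omega)
    rw [Set.mem_ofPred_eq, hilbertFunction, hbot, finrank_bot] at ht
    exact lt_irrefl 0 ht
  refine ⟨⟨⟨fun f hf i => homogeneousComponent_mem_of_functional hL hI hf i,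
    IsArtinianRing.of_finite K _⟩, D, hsocle, hfin, e, fun i j hij => ?_⟩, hsocle⟩
  -- The graded pieces are finite-dimensional over a field, so nondegeneracy on both sides suffices.
  apply LinearMap.IsPerfPair.of_injective
  · rw [injective_iff_map_eq_zero]
    rintro ⟨_, f, hf, rfl⟩ h0
    refine Subtype.ext (Ideal.Quotient.eq_zero_iff_mem.2 ?_)
    refine mem_of_isHomogeneous_of_functional hL hI hf fun j' hj h hh => ?_
    obtain rfl : j' = j := by omega
    rw [mul_comm]
    exact LinearMap.congr_fun h0 ⟨_, h, hh, rfl⟩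
  · rw [injective_iff_map_eq_zero]
    rintro ⟨_, f, hf, rfl⟩ h0
    refine Subtype.ext (Ideal.Quotient.eq_zero_iff_mem.2 ?_)
    refine mem_of_isHomogeneous_of_functional hL hI hf fun i' hi h hh => ?_
    obtain rfl : i' = i := by omega
    exact LinearMap.congr_fun h0 ⟨_, h, hh, rfl⟩

/-- The functional `f ↦ f ∘ F` at the constant monomial, for the contraction action. -/
noncomputable def contractFunctional (F : MvPolynomial σ K) : MvPolynomial σ K →ₗ[K] K :=
  (basisMonomials σ K).constr K fun v => coeff v F

lemma contractFunctional_monomial (F : MvPolynomial σ K) (v : σ →₀ ℕ) (r : K) :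
    contractFunctional F (monomial v r) = r * coeff v F := by
  have h : monomial v r = r • basisMonomials σ K v := by simp [smul_monomial]
  rw [h, map_smul, contractFunctional, Module.Basis.constr_basis, smul_eq_mul]

/-- The pair of monomials `u`, `v` contributes to `x^w` exactly when `v = w + u`. Thus the vanishing
of `f ∘ F` is a statement about one functional on all multiples of `f`. -/
lemma coeff_contract (f F : MvPolynomial σ K) (w : σ →₀ ℕ) :
    coeff w (contract f F) = contractFunctional F (monomial w 1 * f) := by
  classical
  conv_rhs => rw [f.as_sum, Finset.mul_sum, map_sum]
  rw [contract, coeff_sum]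
  refine Finset.sum_congr rfl fun u _ => ?_
  rw [monomial_mul, contractFunctional_monomial, one_mul, coeff_sum,
    Finset.sum_eq_single (w + u)]
  · simp
  · intro v _ hv
    split_ifs with huv
    · rw [coeff_monomial, if_neg]
      rintro rfl
      exact hv (tsub_add_cancel_of_le huv).symm
    · simp
  · intro hv
    simp [notMem_support_iff.1 hv]

lemma contract_eq_zero_iff (f F : MvPolynomial σ K) :
    contract f F = 0 ↔ ∀ h, contractFunctional F (h * f) = 0 := by
  refine ⟨fun h0 h => ?_, fun h0 => ?_⟩
  · induction h using MvPolynomial.induction_on' with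
    | monomial u r =>
      have := coeff_contract f F u
      rw [h0, coeff_zero] at this
      have hr : monomial u r = r • monomial u (1 : K) := by simp [smul_monomial]
      rw [hr, smul_mul_assoc, map_smul, ← this, smul_zero]
    | add p q hp hq => rw [add_mul, map_add, hp, hq, add_zero]
  · ext w
    rw [coeff_contract, h0, coeff_zero]

end Duality

end GorensteinCodimThree

namespace GorensteinCodimThree

/-! ### Height, syzygies of variable powers, and minimal graded maps. -/

section Polynomial

variable {σ K : Type*} [Field K]

/-- Setting the first `k` variables to zero. -/
noncomputable def killVars (K : Type*) [Field K] (n k : ℕ) :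
    MvPolynomial (Fin n) K →ₐ[K] MvPolynomial (Fin n) K :=
  aeval fun i => if (i : ℕ) < k then 0 else X i

lemma killVars_X (n k : ℕ) (i : Fin n) :
    killVars K n k (X i) = if (i : ℕ) < k then 0 else X i := aeval_X _ _

lemma killVars_succ_comp (n k : ℕ) :
    (killVars K n (k + 1)).comp (killVars K n k) = killVars K n (k + 1) := by
  refine algHom_ext fun i => ?_
  simp only [AlgHom.comp_apply, killVars_X]
  split_ifs <;> simp_all [killVars_X]
  all_goals omega

/-- These kernels are primes, and they form a strict chain: the variable of index `k` is killed at
stage `k + 1` but not at stage `k`. -/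
lemma le_height_ker_killVars (n k : ℕ) (hk : k ≤ n) :
    (k : ℕ∞) ≤ (RingHom.ker (killVars K n k)).height := by
  induction k with
  | zero => simp
  | succ k ih =>
    have hlt : RingHom.ker (killVars K n k) < RingHom.ker (killVars K n (k + 1)) := by
      refine lt_of_le_of_ne (fun f hf => ?_) fun heq => ?_
      · rw [RingHom.mem_ker] at hf ⊢
        rw [← killVars_succ_comp, AlgHom.comp_apply, hf, map_zero]
      · have hmem : (X ⟨k, hk⟩ : MvPolynomial (Fin n) K) ∈ RingHom.ker (killVars K n (k + 1)) := by
          simp [RingHom.mem_ker, killVars_X]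
        rw [← heq, RingHom.mem_ker, killVars_X, if_neg (lt_irrefl _)] at hmem
        exact X_ne_zero _ hmem
    have hprime (j : ℕ) : (RingHom.ker (killVars K n j)).IsPrime := RingHom.ker_isPrime _
    have := hprime k
    have := hprime (k + 1)
    push_cast
    exact (add_le_add_left (ih (by omega)) 1).trans (Ideal.height_add_one_le_of_lt_of_isPrime hlt)

/-- A proper ideal of `K[x_1, …, x_n]` that contains a power of every variable has height `n`. -/
theorem height_eq_of_X_pow_mem {n : ℕ} {I : Ideal (MvPolynomial (Fin n) K)} (hI : I ≠ ⊤)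
    (hX : ∀ i, ∃ k : ℕ, (X i : MvPolynomial (Fin n) K) ^ k ∈ I) : I.height = n := by
  refine le_antisymm ?_ ?_
  · have h := Ideal.height_le_ringKrullDim_of_ne_top hI
    rw [MvPolynomial.ringKrullDim_of_isNoetherianRing, ringKrullDim_eq_zero_of_field, zero_add,
      Nat.card_eq_fintype_card, Fintype.card_fin] at h
    exact_mod_cast h
  · rw [Ideal.height_eq_inf_minimalPrimes]
    refine le_iInf₂ fun J hJ => ?_
    have hJp : J.IsPrime := hJ.isPrime
    refine (le_height_ker_killVars (K := K) n n le_rfl).trans (Ideal.height_mono fun f hf => ?_)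
    -- With all variables killed, what remains is the constant term. The kernel thus lies in the
    -- ideal of the variables, hence in every prime over `I`.
    have hkill : killVars K n n = (Algebra.ofId K _).comp (aeval fun _ => (0 : K)) := by
      refine algHom_ext fun i => ?_
      simp [killVars_X]
    have hcoeff : coeff 0 f = 0 := by
      rw [RingHom.mem_ker, hkill, AlgHom.comp_apply, Algebra.ofId_apply] at hf
      have := (FaithfulSMul.algebraMap_injective K (MvPolynomial (Fin n) K)) (hf.trans (map_zero _).symm)
      simpa [aeval_zero', constantCoeff_eq] using this
    have hspan : Ideal.span (X '' (Set.univ : Set (Fin n))) ≤ J := by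
      rw [Ideal.span_le]
      rintro _ ⟨i, -, rfl⟩
      obtain ⟨k, hk⟩ := hX i
      exact hJp.mem_of_pow_mem k (hJ.le hk)
    refine hspan (mem_ideal_span_X_image.2 fun m hm => ?_)
    by_contra! h0
    obtain rfl : m = 0 := Finsupp.ext fun i => h0 i (Set.mem_univ i)
    exact mem_support_iff.1 hm hcoeff

lemma mem_span_X_pow_pair {i j : σ} {p q : ℕ} {f : MvPolynomial σ K} :
    f ∈ Ideal.span {(X i : MvPolynomial σ K) ^ p, X j ^ q} ↔
      ∀ d ∈ f.support, p ≤ d i ∨ q ≤ d j := by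
  have h : ({X i ^ p, X j ^ q} : Set (MvPolynomial σ K)) =
      (fun s => monomial s (1 : K)) '' {Finsupp.single i p, Finsupp.single j q} := by
    simp [Set.image_pair, X_pow_eq_monomial]
  rw [h, mem_ideal_span_monomial_image]
  simp [Finsupp.single_le_iff]

/-- Powers of three distinct variables form a regular sequence. -/
lemma mem_span_X_pow_pair_of_X_pow_mul_mem {i j k : σ} (hik : k ≠ i) (hjk : k ≠ j) {p q n : ℕ}
    {f : MvPolynomial σ K}
    (hf : X k ^ n * f ∈ Ideal.span {(X i : MvPolynomial σ K) ^ p, X j ^ q}) :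
    f ∈ Ideal.span {(X i : MvPolynomial σ K) ^ p, X j ^ q} := by
  rw [mem_span_X_pow_pair] at hf ⊢
  intro d hd
  have := hf (Finsupp.single k n + d) (by
    rw [mem_support_iff, X_pow_eq_monomial, coeff_monomial_mul, one_mul]
    exact mem_support_iff.1 hd)
  simpa [Finsupp.single_apply, hik, hjk] using this

/-- Perturbing a nonzerodivisor modulo `J` by an element that is nilpotent modulo `J`. -/
lemma mem_of_sub_mul_mem {A : Type*} [CommRing A] {J : Ideal A} {u w f : A}
    (hu : ∀ (n : ℕ) (g : A), u ^ n * g ∈ J → g ∈ J) {N : ℕ} (hw : w ^ N ∈ J)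
    (hf : (u - w) * f ∈ J) : f ∈ J := by
  apply hu N
  -- Since `u - w` divides `u^N - w^N` and `w^N` lies in `J`, `u^N * f` lies in `J` too.
  obtain ⟨t, ht⟩ := sub_dvd_pow_sub_pow u w N
  have : u ^ N * f = t * ((u - w) * f) + f * w ^ N := by linear_combination f * ht
  rw [this]
  exact J.add_mem (J.mul_mem_left _ hf) (J.mul_mem_left _ hw)

lemma X_pow_dvd_of_dvd_X_pow_mul {i j : σ} (hij : i ≠ j) {p q : ℕ} {f : MvPolynomial σ K}
    (h : X i ^ p ∣ X j ^ q * f) : X i ^ p ∣ f := by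
  refine (X_prime (R := K)).pow_dvd_of_dvd_mul_left p (fun hd => ?_) h
  exact hij (X_dvd_X.1 ((X_prime (R := K)).dvd_of_dvd_pow hd))

/-- The syzygies of two powers of distinct variables. -/
lemma exists_eq_mul_of_X_pow_mul_eq {i j : σ} (hij : i ≠ j) {p q : ℕ} {f g : MvPolynomial σ K}
    (h : X i ^ p * f = X j ^ q * g) : ∃ r, f = X j ^ q * r ∧ g = X i ^ p * r := by
  obtain ⟨r, rfl⟩ := X_pow_dvd_of_dvd_X_pow_mul hij (Dvd.intro _ h)
  refine ⟨r, mul_left_cancel₀ (pow_ne_zero p (X_ne_zero i)) ?_, rfl⟩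
  rw [h]
  ring

/-- Reduces gradedness and minimality to the entries: a form of positive degree has no constant
term. -/
lemma isMinimalGradedMap_of_isHomogeneous {ι κ : Type*} [Fintype ι] {d : ι → ℤ} {e : κ → ℤ}
    {A : Matrix κ ι (MvPolynomial σ K)}
    (h : ∀ k j, A k j = 0 ∨ ∃ n : ℕ, 1 ≤ n ∧ (A k j).IsHomogeneous n ∧ (n : ℤ) + e k = d j) :
    IsMinimalGradedMap d e A where
  graded t v hv k s hs := by
    classical
    rw [Matrix.mulVec, dotProduct] at hs
    obtain ⟨j, -, hj⟩ := Finset.mem_biUnion.1 (support_sum hs)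
    obtain ⟨s₁, h₁, s₂, h₂, rfl⟩ := Finset.mem_add.1 (support_mul _ _ hj)
    rcases h k j with h0 | ⟨n, -, hn, hnj⟩
    · simp [h0] at h₁
    · have := hv j s₂ h₂
      rw [map_add, degree_eq_of_isHomogeneous hn h₁]
      push_cast
      linarith
  minimal v k := by
    refine Ideal.sum_mem _ fun j _ => Ideal.mul_mem_right _ _ ?_
    change A k j ∈ _
    rcases h k j with h0 | ⟨n, hn1, hn, -⟩
    · rw [h0]; exact Ideal.zero_mem _
    · rw [← Set.image_univ, mem_ideal_span_X_image]
      intro m hm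
      by_contra! h0
      obtain rfl : m = 0 := Finsupp.ext fun i => h0 i (Set.mem_univ i)
      have := hn (mem_support_iff.1 hm)
      rw [map_zero] at this
      omega

end Polynomial

end GorensteinCodimThree

namespace GorensteinCodimThree

/-! ### The dual functional and the inclusion of `I` in its annihilator. -/

section Family

variable (K : Type*) [Field K] (a b c α β γ : ℕ)

/-- The exponent of `x^u y^v z^w`. -/
noncomputable def expo (u v w : ℕ) : Fin 3 →₀ ℕ := Finsupp.equivFunOnFinite.symm ![u, v, w]

@[simp] lemma expo_zero (u v w : ℕ) : expo u v w 0 = u := rfl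
@[simp] lemma expo_one (u v w : ℕ) : expo u v w 1 = v := rfl
@[simp] lemma expo_two (u v w : ℕ) : expo u v w 2 = w := rfl

lemma eq_expo_iff {d : Fin 3 →₀ ℕ} {u v w : ℕ} :
    d = expo u v w ↔ d 0 = u ∧ d 1 = v ∧ d 2 = w := by
  refine ⟨by rintro rfl; simp, fun ⟨h0, h1, h2⟩ => Finsupp.ext fun i => ?_⟩
  fin_cases i <;> assumption

lemma monomial_expo (u v w : ℕ) :
    (monomial (expo u v w) 1 : MvPolynomial (Fin 3) K) = X 0 ^ u * X 1 ^ v * X 2 ^ w := by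
  simp only [X_pow_eq_monomial, monomial_mul, mul_one]
  rw [eq_comm, (eq_expo_iff (d := Finsupp.single 0 u + Finsupp.single 1 v + Finsupp.single 2 w)).2]
  simp

/-- The exponents of the monomials of the dual generator. -/
def IsDualExponent (d : Fin 3 →₀ ℕ) : Prop :=
  ∃ i, d 0 + i * α + 1 = a ∧ d 1 + 1 + β = (i + 1) * b ∧ d 2 + i * γ + 1 = c

open Classical in
/-- The functional dual to the sum of the monomials whose exponents are dual exponents. -/
noncomputable def dualFunctional : MvPolynomial (Fin 3) K →ₗ[K] K :=
  (basisMonomials (Fin 3) K).constr K fun d => if IsDualExponent a b c α β γ d then 1 else 0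

open Classical in
lemma dualFunctional_monomial (d : Fin 3 →₀ ℕ) (r : K) :
    dualFunctional K a b c α β γ (monomial d r) =
      if IsDualExponent a b c α β γ d then r else 0 := by
  have h : monomial d r = r • basisMonomials (Fin 3) K d := by simp [smul_monomial]
  rw [h, map_smul, dualFunctional, Module.Basis.constr_basis, smul_eq_mul]
  simp

variable {K a b c α β γ}

lemma IsDualExponent.degree_eq (hb : α + γ = b) (hβb : β + 1 ≤ b) {d : Fin 3 →₀ ℕ}
    (h : IsDualExponent a b c α β γ d) : d.degree = a + b + c - β - 3 := by
  obtain ⟨i, h0, h1, h2⟩ := h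
  rw [Finsupp.degree_eq_sum, Fin.sum_univ_three]
  subst hb
  have : (i + 1) * (α + γ) = i * α + i * γ + α + γ := by ring
  omega

lemma dualFunctional_of_isHomogeneous (hb : α + γ = b) (hβb : β + 1 ≤ b) (n : ℕ)
    (hn : n ≠ a + b + c - β - 3) (g : MvPolynomial (Fin 3) K) (hg : g.IsHomogeneous n) :
    dualFunctional K a b c α β γ g = 0 := by
  rw [g.as_sum, map_sum]
  refine Finset.sum_eq_zero fun d hd => ?_
  rw [dualFunctional_monomial, if_neg]
  intro h
  exact hn ((degree_eq_of_isHomogeneous hg hd).symm.trans (h.degree_eq hb hβb))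

/-- The parameter `β` only shifts the `y`-exponents; this is the link between `I` and the complete
intersection. -/
lemma dualFunctional_X_pow_mul (h : MvPolynomial (Fin 3) K) :
    dualFunctional K a b c α 0 γ (X 1 ^ β * h) = dualFunctional K a b c α β γ h := by
  induction h using MvPolynomial.induction_on' with
  | monomial d r =>
    rw [X_pow_eq_monomial, monomial_mul, one_mul, dualFunctional_monomial, dualFunctional_monomial]
    congr 1
    simp only [IsDualExponent, Finsupp.add_apply, eq_iff_iff]
    refine exists_congr fun i => ?_
    simp
    omega
  | add p q hp hq => rw [mul_add, map_add, hp, hq, map_add]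

open Classical in
-- The choice of `m` keeps exactly the indices at which no subtraction truncates. Since `α` is
-- positive the terms have distinct `x`-exponents, so no coefficients add up.
lemma coeff_dualGenerator (hα : 1 ≤ α) (hβb : β + 1 ≤ b) {m : ℕ}
    (hm : IsGreatest {j : ℕ | (0 : ℤ) ≤ (a : ℤ) - 1 - j * α ∧ (0 : ℤ) ≤ (c : ℤ) - 1 - j * γ} m)
    (d : Fin 3 →₀ ℕ) :
    coeff d (dualGenerator K a b c α β γ m) = if IsDualExponent a b c α β γ d then 1 else 0 := by
  have key : ∀ j, j ≤ m ↔ j * α + 1 ≤ a ∧ j * γ + 1 ≤ c := by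
    intro j
    constructor
    · intro hj
      obtain ⟨h1, h2⟩ := hm.1
      have := Nat.mul_le_mul_right α hj
      have := Nat.mul_le_mul_right γ hj
      zify at *
      constructor <;> linarith
    · rintro ⟨h1, h2⟩
      refine hm.2 ⟨?_, ?_⟩ <;> zify at * <;> linarith
  simp only [dualGenerator, ← monomial_expo, coeff_sum, coeff_monomial]
  have hterm : ∀ i ∈ Finset.range (m + 1),
      (expo (a - 1 - i * α) ((i + 1) * b - 1 - β) (c - 1 - i * γ) = d ↔
        d 0 + i * α + 1 = a ∧ d 1 + 1 + β = (i + 1) * b ∧ d 2 + i * γ + 1 = c) := by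
    intro i hi
    obtain ⟨h1, h2⟩ := (key i).1 (by simpa [Nat.lt_succ_iff] using hi)
    have h3 : b ≤ (i + 1) * b := Nat.le_mul_of_pos_left b i.succ_pos
    rw [eq_comm, eq_expo_iff]
    omega
  split_ifs with h
  · obtain ⟨i, hi⟩ := h
    have him : i ∈ Finset.range (m + 1) :=
      Finset.mem_range_succ_iff.2 ((key i).2 ⟨by omega, by omega⟩)
    rw [Finset.sum_eq_single i, if_pos ((hterm i him).2 hi)]
    · intro j hj hji
      rw [if_neg]
      intro hd
      obtain ⟨h1, -, -⟩ := (hterm j hj).1 hd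
      have : i * α = j * α := by omega
      exact hji (Nat.eq_of_mul_eq_mul_right hα this).symm
    · exact fun h => absurd him h
  · refine Finset.sum_eq_zero fun i hi => if_neg fun hd => h ⟨i, (hterm i hi).1 hd⟩

lemma contractFunctional_dualGenerator (hα : 1 ≤ α) (hβb : β + 1 ≤ b) {m : ℕ}
    (hm : IsGreatest {j : ℕ | (0 : ℤ) ≤ (a : ℤ) - 1 - j * α ∧ (0 : ℤ) ≤ (c : ℤ) - 1 - j * γ} m) :
    contractFunctional (dualGenerator K a b c α β γ m) = dualFunctional K a b c α β γ := by
  classical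
  refine (basisMonomials (Fin 3) K).ext fun d => ?_
  rw [contractFunctional, dualFunctional, Module.Basis.constr_basis, Module.Basis.constr_basis,
    coeff_dualGenerator hα hβb hm]

/-- The annihilator of a functional, as an ideal. -/
def functionalAnnihilator (L : MvPolynomial (Fin 3) K →ₗ[K] K) : Ideal (MvPolynomial (Fin 3) K) where
  carrier := {f | ∀ h, L (h * f) = 0}
  zero_mem' h := by simp
  add_mem' hf hg h := by rw [mul_add, map_add, hf, hg, add_zero]
  smul_mem' r f hf h := by rw [smul_eq_mul, ← mul_assoc]; exact hf _

lemma mem_functionalAnnihilator {L : MvPolynomial (Fin 3) K →ₗ[K] K} {f : MvPolynomial (Fin 3) K} :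
    f ∈ functionalAnnihilator L ↔ ∀ h, L (h * f) = 0 := Iff.rfl

lemma mem_functionalAnnihilator_of_monomial {L : MvPolynomial (Fin 3) K →ₗ[K] K}
    {f : MvPolynomial (Fin 3) K} (h : ∀ d, L (monomial d 1 * f) = 0) :
    f ∈ functionalAnnihilator L := by
  intro g
  induction g using MvPolynomial.induction_on' with
  | monomial d r =>
    have hr : monomial d r = r • monomial d (1 : K) := by simp [smul_monomial]
    rw [hr, smul_mul_assoc, map_smul, h, smul_zero]
  | add p q hp hq => rw [add_mul, map_add, hp, hq, add_zero]

lemma monomial_mem_functionalAnnihilator {e : Fin 3 →₀ ℕ}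
    (h : ∀ d, ¬ IsDualExponent a b c α β γ (d + e)) :
    monomial e 1 ∈ functionalAnnihilator (dualFunctional K a b c α β γ) := by
  refine mem_functionalAnnihilator_of_monomial fun d => ?_
  rw [monomial_mul, dualFunctional_monomial, if_neg (h d)]

lemma X_zero_pow_mem_annihilator :
    X 0 ^ a ∈ functionalAnnihilator (dualFunctional K a b c α β γ) := by
  have := monomial_mem_functionalAnnihilator (K := K) (a := a) (b := b) (c := c) (α := α) (β := β)
    (γ := γ) (e := expo a 0 0) (by
      rintro d ⟨i, h0, -, -⟩
      simp only [Finsupp.add_apply, expo_zero] at h0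
      omega)
  simpa [monomial_expo] using this

lemma X_two_pow_mem_annihilator :
    X 2 ^ c ∈ functionalAnnihilator (dualFunctional K a b c α β γ) := by
  have := monomial_mem_functionalAnnihilator (K := K) (a := a) (b := b) (c := c) (α := α) (β := β)
    (γ := γ) (e := expo 0 0 c) (by
      rintro d ⟨i, -, -, h2⟩
      simp only [Finsupp.add_apply, expo_two] at h2
      omega)
  simpa [monomial_expo] using this

/-- The term `i = 0` of `F` has `y`-exponent `b - β - 1`, too small; every later term has
`x`-exponent at most `a - 1 - α`, too small. -/
lemma X_zero_pow_mul_mem_annihilator (hβb : β + 1 ≤ b) :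
    X 0 ^ (a - α) * X 1 ^ (b - β) ∈ functionalAnnihilator (dualFunctional K a b c α β γ) := by
  have := monomial_mem_functionalAnnihilator (K := K) (a := a) (b := b) (c := c) (α := α) (β := β)
    (γ := γ) (e := expo (a - α) (b - β) 0) (by
      rintro d ⟨i, h0, h1, -⟩
      simp only [Finsupp.add_apply, expo_zero, expo_one] at h0 h1
      cases i with
      | zero => omega
      | succ i => rw [Nat.add_mul] at h0; omega)
  simpa [monomial_expo] using this

lemma mul_X_two_pow_mem_annihilator (hβb : β + 1 ≤ b) :
    X 1 ^ (b - β) * X 2 ^ (c - γ) ∈ functionalAnnihilator (dualFunctional K a b c α β γ) := by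
  have := monomial_mem_functionalAnnihilator (K := K) (a := a) (b := b) (c := c) (α := α) (β := β)
    (γ := γ) (e := expo 0 (b - β) (c - γ)) (by
      rintro d ⟨i, -, h1, h2⟩
      simp only [Finsupp.add_apply, expo_two, expo_one] at h2 h1
      cases i with
      | zero => omega
      | succ i => rw [Nat.add_mul] at h2; omega)
  simpa [monomial_expo] using this

/-- Multiplying a monomial by `y^b` reaches term `i + 1` of `F` exactly when multiplying it by `x^α
z^γ` reaches term `i`. Term 0 is out of reach for `y^b`, its `y`-exponent being less than `b`. -/
lemma binomial_mem_annihilator :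
    X 1 ^ b - X 0 ^ α * X 2 ^ γ ∈ functionalAnnihilator (dualFunctional K a b c α β γ) := by
  refine mem_functionalAnnihilator_of_monomial fun d => ?_
  have h1 : (X 1 ^ b : MvPolynomial (Fin 3) K) = monomial (expo 0 b 0) 1 := by
    simp [monomial_expo]
  have h2 : (X 0 ^ α * X 2 ^ γ : MvPolynomial (Fin 3) K) = monomial (expo α 0 γ) 1 := by
    simp [monomial_expo]
  rw [h1, h2, mul_sub, monomial_mul, monomial_mul, map_sub, dualFunctional_monomial,
    dualFunctional_monomial, sub_eq_zero]
  congr 1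
  simp only [IsDualExponent, Finsupp.add_apply, expo_zero, expo_one, expo_two, eq_iff_iff]
  constructor
  · rintro ⟨i, h0, h1, h2⟩
    cases i with
    | zero => omega
    | succ i =>
      rw [Nat.add_mul] at h0 h1 h2
      exact ⟨i, by omega, by omega, by omega⟩
  · rintro ⟨i, h0, h1, h2⟩
    exact ⟨i + 1, by rw [Nat.add_mul]; omega, by rw [Nat.add_mul]; omega, by
      rw [Nat.add_mul]; omega⟩

lemma gorensteinIdeal_le_annihilator (hβb : β + 1 ≤ b) :
    gorensteinIdeal K a b c α β γ ≤ functionalAnnihilator (dualFunctional K a b c α β γ) := by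
  rw [gorensteinIdeal, Ideal.span_le]
  rintro f (rfl | rfl | rfl | rfl | rfl)
  · exact X_zero_pow_mem_annihilator
  · exact binomial_mem_annihilator
  · exact X_two_pow_mem_annihilator
  · exact X_zero_pow_mul_mem_annihilator hβb
  · exact mul_X_two_pow_mem_annihilator hβb

lemma completeIntersection_le_annihilator :
    completeIntersection K a b c α γ ≤ functionalAnnihilator (dualFunctional K a b c α β γ) := by
  rw [completeIntersection, Ideal.span_le]
  rintro f (rfl | rfl | rfl)
  · exact X_zero_pow_mem_annihilator
  · exact binomial_mem_annihilator
  · exact X_two_pow_mem_annihilator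

/-! ### Standard monomials and the equality of `I` with the annihilator. -/

variable (a b c α β γ) in
/-- The exponents of the monomials that form a basis of `R/I`. -/
def standardExponents : Set (Fin 3 →₀ ℕ) :=
  {d | d 0 < a ∧ d 1 < b ∧ d 2 < c ∧ (b ≤ d 1 + β → d 0 + α < a ∧ d 2 + γ < c)}

lemma finite_standardExponents : (standardExponents a b c α β γ).Finite := by
  refine (Set.finite_Iic (expo a b c)).subset ?_
  rintro d ⟨h0, h1, h2, -⟩ i
  fin_cases i <;> simp <;> omega

/-- Induction on the `y`-exponent, with the other two free: trading `y^b` for `x^α z^γ` lowers it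
while raising them. When this does not apply, a nonstandard monomial is divisible by a monomial
generator. -/
lemma monomial_mem_sup (hαa : α + 1 ≤ a) (hγc : γ + 1 ≤ c)
    (hβb : β + 1 ≤ b) (v : ℕ) : ∀ u w : ℕ, (monomial (expo u v w) 1 : MvPolynomial (Fin 3) K) ∈
      restrictSupport K (standardExponents a b c α β γ) ⊔
        (gorensteinIdeal K a b c α β γ).restrictScalars K := by
  induction v using Nat.strong_induction_on with
  | _ v ih =>
  intro u w
  have hmem : ∀ f ∈ ({X 0 ^ a, X 1 ^ b - X 0 ^ α * X 2 ^ γ, X 2 ^ c,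
      X 0 ^ (a - α) * X 1 ^ (b - β), X 1 ^ (b - β) * X 2 ^ (c - γ)} :
        Set (MvPolynomial (Fin 3) K)), f ∈ gorensteinIdeal K a b c α β γ :=
    fun f hf => Ideal.subset_span hf
  have hI : ∀ {f}, f ∈ gorensteinIdeal K a b c α β γ →
      f ∈ restrictSupport K (standardExponents a b c α β γ) ⊔
        (gorensteinIdeal K a b c α β γ).restrictScalars K :=
    fun hf => Submodule.mem_sup_right hf
  rw [monomial_expo]
  rcases lt_or_ge u a with hu | hu
  swap
  · apply hI
    obtain ⟨u, rfl⟩ := Nat.exists_eq_add_of_le hu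
    rw [pow_add, mul_assoc, mul_assoc]
    exact Ideal.mul_mem_right _ _ (hmem _ (by simp))
  rcases lt_or_ge w c with hw | hw
  swap
  · apply hI
    obtain ⟨w, rfl⟩ := Nat.exists_eq_add_of_le' hw
    rw [pow_add, ← mul_assoc]
    exact Ideal.mul_mem_left _ _ (hmem _ (by simp))
  rcases lt_or_ge v b with hv | hv
  swap
  · obtain ⟨v, rfl⟩ := Nat.exists_eq_add_of_le hv
    have h1 := ih v (by omega) (u + α) (w + γ)
    have h2 : X 0 ^ u * X 1 ^ v * X 2 ^ w * (X 1 ^ b - X 0 ^ α * X 2 ^ γ) ∈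
        gorensteinIdeal K a b c α β γ := Ideal.mul_mem_left _ _ (hmem _ (by simp))
    have h3 := Submodule.add_mem _ h1 (hI h2)
    rw [monomial_expo] at h3
    convert h3 using 1
    ring
  by_cases hvβ : b ≤ v + β
  · obtain ⟨k, hk⟩ := Nat.exists_eq_add_of_le (show b - β ≤ v by omega)
    rcases lt_or_ge (u + α) a with hu' | hu'
    swap
    · apply hI
      obtain ⟨l, hl⟩ := Nat.exists_eq_add_of_le (show a - α ≤ u by omega)
      have : (X 0 ^ u * X 1 ^ v * X 2 ^ w : MvPolynomial (Fin 3) K) =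
          X 0 ^ l * X 1 ^ k * X 2 ^ w * (X 0 ^ (a - α) * X 1 ^ (b - β)) := by
        rw [hk, hl]; ring
      rw [this]
      exact Ideal.mul_mem_left _ _ (hmem _ (by simp))
    rcases lt_or_ge (w + γ) c with hw' | hw'
    swap
    · apply hI
      obtain ⟨l, hl⟩ := Nat.exists_eq_add_of_le (show c - γ ≤ w by omega)
      have : (X 0 ^ u * X 1 ^ v * X 2 ^ w : MvPolynomial (Fin 3) K) =
          X 0 ^ u * X 1 ^ k * X 2 ^ l * (X 1 ^ (b - β) * X 2 ^ (c - γ)) := by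
        rw [hk, hl]; ring
      rw [this]
      exact Ideal.mul_mem_left _ _ (hmem _ (by simp))
    · rw [← monomial_expo]
      refine Submodule.mem_sup_left ((monomial_mem_restrictSupport K).2 (Or.inl ?_))
      exact ⟨hu, hv, hw, fun _ => ⟨hu', hw'⟩⟩
  · rw [← monomial_expo]
    refine Submodule.mem_sup_left ((monomial_mem_restrictSupport K).2 (Or.inl ?_))
    exact ⟨hu, hv, hw, fun h => absurd h hvβ⟩

lemma restrictSupport_sup_gorensteinIdeal (hαa : α + 1 ≤ a) (hγc : γ + 1 ≤ c) (hβb : β + 1 ≤ b) :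
    restrictSupport K (standardExponents a b c α β γ) ⊔
        (gorensteinIdeal K a b c α β γ).restrictScalars K = ⊤ := by
  rw [eq_top_iff]
  intro f _
  rw [f.as_sum]
  refine Submodule.sum_mem _ fun d _ => ?_
  have hr : monomial d (coeff d f) = coeff d f • monomial (expo (d 0) (d 1) (d 2)) (1 : K) := by
    rw [← eq_expo_iff.2 ⟨rfl, rfl, rfl⟩]
    simp [smul_monomial]
  rw [hr]
  exact Submodule.smul_mem _ _ (monomial_mem_sup hαa hγc hβb _ _ _)

/-- The standard monomials are linearly independent modulo the annihilator of the dual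
functional: every one of them is detected by one monomial. -/
lemma eq_zero_of_mem_restrictSupport (hβb : β + 1 ≤ b) {f : MvPolynomial (Fin 3) K}
    (hf : f ∈ restrictSupport K (standardExponents a b c α β γ))
    (hfL : f ∈ functionalAnnihilator (dualFunctional K a b c α β γ)) : f = 0 := by
  classical
  rw [mem_restrictSupport_iff] at hf
  by_contra hne
  obtain ⟨s, hs⟩ := support_nonempty.2 hne
  obtain ⟨h0, h1, h2, h3⟩ := hf hs
  have key : ∃ e : Fin 3 →₀ ℕ, ∀ t ∈ f.support,
      (IsDualExponent a b c α β γ (e + t) ↔ t = s) := by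
    by_cases hv : b ≤ s 1 + β
    · obtain ⟨h4, h5⟩ := h3 hv
      -- The complement of `s` in the term `i = 1` of `F`, since the `y`-exponent of `s` is too
      -- large for `i = 0`. As standard `y`-exponents are below `b`, the shifted `t` has
      -- `y`-exponent plus `1 + β` strictly between `b` and `3b`, forcing `i = 1`.
      refine ⟨expo (a - 1 - α - s 0) (2 * b - 1 - β - s 1) (c - 1 - γ - s 2), fun t ht => ?_⟩
      obtain ⟨t0, t1, t2, t3⟩ := hf ht
      constructor
      · rintro ⟨i, hi0, hi1, hi2⟩
        simp only [Finsupp.add_apply, expo_zero, expo_one, expo_two] at hi0 hi1 hi2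
        match i with
        | 0 => omega
        | 1 => rw [(eq_expo_iff (d := s)).2 ⟨rfl, rfl, rfl⟩, eq_expo_iff]; omega
        | i + 2 =>
          have : (i + 2 + 1) * b = i * b + 3 * b := by ring
          omega
      · rintro rfl
        refine ⟨1, ?_, ?_, ?_⟩ <;> simp only [Finsupp.add_apply, expo_zero, expo_one, expo_two] <;>
          omega
    -- The complement of `s` in the term `i = 0`; here the bound is below `2b`, which excludes every
    -- later term.
    · refine ⟨expo (a - 1 - s 0) (b - 1 - β - s 1) (c - 1 - s 2), fun t ht => ?_⟩
      obtain ⟨t0, t1, t2, t3⟩ := hf ht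
      constructor
      · rintro ⟨i, hi0, hi1, hi2⟩
        simp only [Finsupp.add_apply, expo_zero, expo_one, expo_two] at hi0 hi1 hi2
        match i with
        | 0 => rw [(eq_expo_iff (d := s)).2 ⟨rfl, rfl, rfl⟩, eq_expo_iff]; omega
        | i + 1 =>
          have : (i + 1 + 1) * b = i * b + 2 * b := by ring
          omega
      · rintro rfl
        refine ⟨0, ?_, ?_, ?_⟩ <;> simp only [Finsupp.add_apply, expo_zero, expo_one, expo_two] <;>
          omega
  obtain ⟨e, he⟩ := key
  have h := hfL (monomial e 1)
  rw [f.as_sum, Finset.mul_sum, map_sum, Finset.sum_eq_single s] at h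
  · rw [monomial_mul, one_mul, dualFunctional_monomial, if_pos ((he s hs).2 rfl)] at h
    exact mem_support_iff.1 hs h
  · intro t ht hts
    rw [monomial_mul, dualFunctional_monomial, if_neg fun h => hts ((he t ht).1 h)]
  · exact fun h => absurd hs h

theorem gorensteinIdeal_eq_annihilator (hαa : α + 1 ≤ a)
    (hγc : γ + 1 ≤ c) (hβb : β + 1 ≤ b) :
    gorensteinIdeal K a b c α β γ = functionalAnnihilator (dualFunctional K a b c α β γ) := by
  refine le_antisymm (gorensteinIdeal_le_annihilator hβb) fun f hf => ?_
  have htop : f ∈ restrictSupport K (standardExponents a b c α β γ) ⊔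
        (gorensteinIdeal K a b c α β γ).restrictScalars K := by
    rw [restrictSupport_sup_gorensteinIdeal hαa hγc hβb]; trivial
  obtain ⟨g, hg, k, hk, rfl⟩ := Submodule.mem_sup.1 htop
  have hk : k ∈ gorensteinIdeal K a b c α β γ := hk
  have hg0 : g = 0 := eq_zero_of_mem_restrictSupport hβb hg
    ((Ideal.add_mem_iff_left _ (gorensteinIdeal_le_annihilator hβb hk)).1 hf)
  rwa [hg0, zero_add]

lemma finiteDimensional_quotient_gorensteinIdeal (hαa : α + 1 ≤ a)
    (hγc : γ + 1 ≤ c) (hβb : β + 1 ≤ b) :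
    FiniteDimensional K (MvPolynomial (Fin 3) K ⧸ gorensteinIdeal K a b c α β γ) := by
  have : Finite (standardExponents a b c α β γ) := finite_standardExponents
  have : FiniteDimensional K (restrictSupport K (standardExponents a b c α β γ)) :=
    (basisRestrictSupport K _).finiteDimensional_of_finite
  refine Module.Finite.of_surjective
    ((Ideal.Quotient.mkₐ K (gorensteinIdeal K a b c α β γ)).toLinearMap.domRestrict
      (restrictSupport K (standardExponents a b c α β γ))) fun q => ?_
  obtain ⟨f, rfl⟩ := Ideal.Quotient.mk_surjective q
  have htop : f ∈ restrictSupport K (standardExponents a b c α β γ) ⊔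
        (gorensteinIdeal K a b c α β γ).restrictScalars K := by
    rw [restrictSupport_sup_gorensteinIdeal hαa hγc hβb]; trivial
  obtain ⟨g, hg, k, hk, rfl⟩ := Submodule.mem_sup.1 htop
  refine ⟨⟨g, hg⟩, ?_⟩
  refine (Ideal.Quotient.eq.2 ?_).symm
  simpa using hk

/-! ### The colon formula and the dual generator. -/

lemma gorensteinIdeal_le_colon (hβb : β ≤ b) (hαa : α ≤ a) (hγc : γ ≤ c) :
    gorensteinIdeal K a b c α β γ ≤ (completeIntersection K a b c α γ).colon {X 1 ^ β} := by
  have hx : X 0 ^ a ∈ completeIntersection K a b c α γ := Ideal.subset_span (by simp)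
  have hy : X 1 ^ b - X 0 ^ α * X 2 ^ γ ∈ completeIntersection K a b c α γ :=
    Ideal.subset_span (by simp)
  have hz : X 2 ^ c ∈ completeIntersection K a b c α γ := Ideal.subset_span (by simp)
  obtain ⟨a', rfl⟩ := Nat.exists_eq_add_of_le' hαa
  obtain ⟨b', rfl⟩ := Nat.exists_eq_add_of_le' hβb
  obtain ⟨c', rfl⟩ := Nat.exists_eq_add_of_le' hγc
  rw [gorensteinIdeal, Ideal.span_le]
  rintro f (rfl | rfl | rfl | rfl | rfl) <;>
    rw [SetLike.mem_coe, Submodule.mem_colon_singleton, smul_eq_mul]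
  · exact Ideal.mul_mem_right _ _ hx
  · exact Ideal.mul_mem_right _ _ hy
  · exact Ideal.mul_mem_right _ _ hz
  · convert Ideal.add_mem _ (Ideal.mul_mem_left _ (X 0 ^ a') hy) (Ideal.mul_mem_left _ (X 2 ^ γ) hx)
      using 1
    simp only [Nat.add_sub_cancel]
    ring
  · convert Ideal.add_mem _ (Ideal.mul_mem_left _ (X 2 ^ c') hy) (Ideal.mul_mem_left _ (X 0 ^ α) hz)
      using 1
    simp only [Nat.add_sub_cancel]
    ring

theorem gorensteinIdeal_eq_colon (hαa : α + 1 ≤ a)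
    (hγc : γ + 1 ≤ c) (hβb : β + 1 ≤ b) :
    gorensteinIdeal K a b c α β γ = (completeIntersection K a b c α γ).colon {X 1 ^ β} := by
  refine le_antisymm (gorensteinIdeal_le_colon (by omega) (by omega) (by omega)) fun f hf => ?_
  rw [Submodule.mem_colon_singleton, smul_eq_mul] at hf
  rw [gorensteinIdeal_eq_annihilator hαa hγc hβb]
  intro h
  rw [← dualFunctional_X_pow_mul]
  -- Only the inclusion of the complete intersection in the annihilator for `β = 0` is needed, not
  -- equality.
  have := completeIntersection_le_annihilator (β := 0) hf h
  rwa [show X 1 ^ β * (h * f) = h * (f * X 1 ^ β) by ring]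

theorem isMacaulayDualGenerator_dualGenerator (hα : 1 ≤ α) (hαa : α + 1 ≤ a)
    (hγc : γ + 1 ≤ c) (hβb : β + 1 ≤ b) {m : ℕ}
    (hm : IsGreatest {j : ℕ | (0 : ℤ) ≤ (a : ℤ) - 1 - j * α ∧ (0 : ℤ) ≤ (c : ℤ) - 1 - j * γ} m) :
    IsMacaulayDualGenerator (gorensteinIdeal K a b c α β γ) (dualGenerator K a b c α β γ m) := by
  rw [IsMacaulayDualGenerator, gorensteinIdeal_eq_annihilator hαa hγc hβb]
  ext f
  rw [Set.mem_ofPred_eq, contract_eq_zero_iff, contractFunctional_dualGenerator hα hβb hm]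
  rfl

lemma exists_isGreatest_dualGenerator (hα : 1 ≤ α) (ha : 1 ≤ a) (hc : 1 ≤ c) :
    ∃ m, IsGreatest
      {j : ℕ | (0 : ℤ) ≤ (a : ℤ) - 1 - j * α ∧ (0 : ℤ) ≤ (c : ℤ) - 1 - j * γ} m := by
  apply BddAbove.exists_isGreatest_of_nonempty
  · refine ⟨a, fun j hj => ?_⟩
    have h1 := hj.1
    have : j ≤ j * α := Nat.le_mul_of_pos_right j hα
    zify at *
    linarith
  · exact ⟨0, by simp; omega⟩

/-! ### Embedding codimension. -/

lemma mem_standardExponents_of_degree_eq_one (hα : 1 ≤ α) (hαa : α + 1 ≤ a) (hγ : 1 ≤ γ)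
    (hγc : γ + 1 ≤ c) (hβb : β + 1 ≤ b) (hb : α + γ = b) {d : Fin 3 →₀ ℕ} (hd : d.degree = 1) :
    d ∈ standardExponents a b c α β γ := by
  rw [Finsupp.degree_eq_sum, Fin.sum_univ_three] at hd
  refine ⟨by omega, by omega, by omega, by omega⟩

/-- All three variables are standard monomials, so `I` contains no nonzero linear form. -/
theorem hilbertFunction_gorensteinIdeal_one (hα : 1 ≤ α) (hαa : α + 1 ≤ a) (hγ : 1 ≤ γ)
    (hγc : γ + 1 ≤ c) (hβb : β + 1 ≤ b) (hb : α + γ = b) :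
    hilbertFunction (gorensteinIdeal K a b c α β γ) 1 = 3 := by
  set I := gorensteinIdeal K a b c α β γ
  have hinj : ∀ f : MvPolynomial (Fin 3) K, f.IsHomogeneous 1 → f ∈ I → f = 0 := by
    intro f hf hfI
    refine eq_zero_of_mem_restrictSupport hβb ?_ (gorensteinIdeal_le_annihilator hβb hfI)
    rw [mem_restrictSupport_iff]
    intro d hd
    exact mem_standardExponents_of_degree_eq_one hα hαa hγ hγc hβb hb
      (degree_eq_of_isHomogeneous hf hd)
  have hind : LinearIndependent K fun i : Fin 3 => Ideal.Quotient.mkₐ K I (X i) := by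
    rw [Fintype.linearIndependent_iff]
    intro g hg
    have hsum : ∑ i, g i • (X i : MvPolynomial (Fin 3) K) = 0 := by
      refine hinj _ ?_ ?_
      · exact IsHomogeneous.sum _ _ _ fun i _ => by
          rw [smul_eq_C_mul]
          simpa using (isHomogeneous_C (Fin 3) (g i)).mul (isHomogeneous_X K i)
      · rw [← Ideal.Quotient.eq_zero_iff_mem, ← Ideal.Quotient.mkₐ_eq_mk K]
        simpa only [map_sum, map_smul, Ideal.Quotient.mkₐ_eq_mk] using hg
    intro i
    have := congrArg (coeff (Finsupp.single i 1)) hsum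
    simpa [coeff_sum, coeff_X, Finsupp.single_left_inj] using this
  rw [hilbertFunction, gradedPiece, homogeneousSubmodule_one_eq_span_X, Submodule.map_span,
    ← Set.range_comp]
  exact (finrank_span_eq_card hind).trans (Fintype.card_fin 3)

end Family

end GorensteinCodimThree

namespace GorensteinCodimThree

/-! ### The minimal graded free resolution. -/

section Resolution

variable {K : Type*} [Field K] {a b c α β γ : ℕ}

lemma skewMatrix_transpose :
    (skewMatrix K a b c α β γ).transpose = -skewMatrix K a b c α β γ := by
  ext i j : 1
  fin_cases i <;> fin_cases j <;> simp [skewMatrix]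

lemma skewMatrix_mulVec (v : Fin 5 → MvPolynomial (Fin 3) K) :
    (skewMatrix K a b c α β γ).mulVec v =
      ![X 1 ^ (b - β) * v 1 - X 0 ^ α * v 3,
        X 2 ^ γ * v 2 - X 1 ^ (b - β) * v 0,
        X 1 ^ β * v 3 - X 2 ^ γ * v 1 - X 0 ^ (a - α) * v 4,
        X 0 ^ α * v 0 - X 1 ^ β * v 2 + X 2 ^ (c - γ) * v 4,
        X 0 ^ (a - α) * v 2 - X 2 ^ (c - γ) * v 3] := by
  ext i : 1
  fin_cases i <;>
    simp [skewMatrix, Matrix.mulVec, dotProduct, Fin.sum_univ_five] <;> ring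

lemma generatorRow_mulVec (v : Fin 5 → MvPolynomial (Fin 3) K) :
    (generatorRow K a b c α β γ).mulVec v =
      ![X 2 ^ c * v 0 + X 0 ^ a * v 1 + X 1 ^ (b - β) * X 2 ^ (c - γ) * v 2 +
        X 0 ^ (a - α) * X 1 ^ (b - β) * v 3 + (X 1 ^ b - X 0 ^ α * X 2 ^ γ) * v 4] := by
  ext i : 1
  fin_cases i
  simp [generatorRow, Matrix.mulVec, dotProduct, Fin.sum_univ_five]

lemma generatorRow_transpose_mulVec (v : Fin 1 → MvPolynomial (Fin 3) K) :
    (generatorRow K a b c α β γ).transpose.mulVec v =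
      ![X 2 ^ c * v 0, X 0 ^ a * v 0, X 1 ^ (b - β) * X 2 ^ (c - γ) * v 0,
        X 0 ^ (a - α) * X 1 ^ (b - β) * v 0, (X 1 ^ b - X 0 ^ α * X 2 ^ γ) * v 0] := by
  ext i : 1
  fin_cases i <;> simp [generatorRow, Matrix.mulVec, dotProduct]

lemma isHomogeneous_binomial (hb : α + γ = b) :
    (X 1 ^ b - X 0 ^ α * X 2 ^ γ : MvPolynomial (Fin 3) K).IsHomogeneous b := by
  refine (isHomogeneous_X_pow 1 b).sub ?_
  rw [← hb]
  exact (isHomogeneous_X_pow 0 α).mul (isHomogeneous_X_pow 2 γ)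

/-- Serves both the row and its transpose: by `α + γ = b`, paired twists of the first and second
free modules add up to `a + b + c - β`. -/
lemma generatorRow_entry (hα : 1 ≤ α) (hαa : α + 1 ≤ a) (hβb : β + 1 ≤ b) (hγc : γ + 1 ≤ c)
    (hb : α + γ = b) (k : Fin 1) (j : Fin 5) :
    ∃ n : ℕ, 1 ≤ n ∧ (generatorRow K a b c α β γ k j).IsHomogeneous n ∧
      (n : ℤ) = ![(c : ℤ), (a : ℤ), (c : ℤ) + α - β, (a : ℤ) + γ - β, (b : ℤ)] j := by
  fin_cases k
  fin_cases j
  · exact ⟨c, by omega, isHomogeneous_X_pow 2 c, rfl⟩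
  · exact ⟨a, by omega, isHomogeneous_X_pow 0 a, rfl⟩
  · exact ⟨(b - β) + (c - γ), by omega,
      (isHomogeneous_X_pow 1 _).mul (isHomogeneous_X_pow 2 _), by simp; omega⟩
  · exact ⟨(a - α) + (b - β), by omega,
      (isHomogeneous_X_pow 0 _).mul (isHomogeneous_X_pow 1 _), by simp; omega⟩
  · exact ⟨b, by omega, isHomogeneous_binomial hb, rfl⟩

lemma isMinimalGradedMap_generatorRow (hα : 1 ≤ α) (hαa : α + 1 ≤ a) (hβb : β + 1 ≤ b)
    (hγc : γ + 1 ≤ c) (hb : α + γ = b) :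
    IsMinimalGradedMap ![(c : ℤ), (a : ℤ), (c : ℤ) + α - β, (a : ℤ) + γ - β, (b : ℤ)]
      (fun _ : Fin 1 => (0 : ℤ)) (generatorRow K a b c α β γ) := by
  refine isMinimalGradedMap_of_isHomogeneous fun k j => Or.inr ?_
  obtain ⟨n, hn, h, hd⟩ := generatorRow_entry (K := K) hα hαa hβb hγc hb k j
  exact ⟨n, hn, h, by rw [add_zero, hd]⟩

lemma isMinimalGradedMap_generatorRow_transpose (hα : 1 ≤ α) (hαa : α + 1 ≤ a)
    (hβb : β + 1 ≤ b) (hγc : γ + 1 ≤ c) (hb : α + γ = b) :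
    IsMinimalGradedMap (fun _ : Fin 1 => (a : ℤ) + b + c - β)
      ![(a : ℤ) + b - β, (b : ℤ) + c - β, (a : ℤ) + γ, (c : ℤ) + α, (a : ℤ) + c - β]
      (generatorRow K a b c α β γ).transpose := by
  refine isMinimalGradedMap_of_isHomogeneous fun k j => Or.inr ?_
  obtain ⟨n, hn, h, hd⟩ := generatorRow_entry (K := K) hα hαa hβb hγc hb j k
  refine ⟨n, hn, h, ?_⟩
  rw [hd]
  fin_cases k <;> simp <;> omega

lemma isMinimalGradedMap_skewMatrix (hα : 1 ≤ α) (hαa : α + 1 ≤ a) (hβ : 1 ≤ β)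
    (hβb : β + 1 ≤ b) (hγ : 1 ≤ γ) (hγc : γ + 1 ≤ c) (hb : α + γ = b) :
    IsMinimalGradedMap
      ![(a : ℤ) + b - β, (b : ℤ) + c - β, (a : ℤ) + γ, (c : ℤ) + α, (a : ℤ) + c - β]
      ![(c : ℤ), (a : ℤ), (c : ℤ) + α - β, (a : ℤ) + γ - β, (b : ℤ)]
      (skewMatrix K a b c α β γ) := by
  have hX (i : Fin 3) {n : ℕ} {s t : ℤ} (hn : 1 ≤ n) (hst : (n : ℤ) + s = t) :
      ∃ m : ℕ, 1 ≤ m ∧ (X i ^ n : MvPolynomial (Fin 3) K).IsHomogeneous m ∧ (m : ℤ) + s = t :=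
    ⟨n, hn, isHomogeneous_X_pow i n, hst⟩
  have hXneg (i : Fin 3) {n : ℕ} {s t : ℤ} (hn : 1 ≤ n) (hst : (n : ℤ) + s = t) :
      ∃ m : ℕ, 1 ≤ m ∧ (-X i ^ n : MvPolynomial (Fin 3) K).IsHomogeneous m ∧ (m : ℤ) + s = t :=
    ⟨n, hn, (isHomogeneous_X_pow i n).neg, hst⟩
  refine isMinimalGradedMap_of_isHomogeneous fun k j => ?_
  fin_cases k <;> fin_cases j <;>
    first
    | exact Or.inl rfl
    | exact Or.inr (hX _ (by omega) (by simp <;> omega))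
    | exact Or.inr (hXneg _ (by omega) (by simp <;> omega))

lemma exact_generatorRow_mkQ :
    Function.Exact (generatorRow K a b c α β γ).mulVecLin
      ((gorensteinIdeal K a b c α β γ).mkQ.comp (LinearMap.proj (0 : Fin 1))) := by
  intro v
  rw [LinearMap.comp_apply, LinearMap.proj_apply, Submodule.mkQ_apply,
    Submodule.Quotient.mk_eq_zero]
  constructor
  · intro hv
    simp only [gorensteinIdeal, Ideal.mem_span_insert, Ideal.mem_span_singleton'] at hv
    obtain ⟨s, _, ⟨t, _, ⟨u, _, ⟨p, _, ⟨q, rfl⟩, rfl⟩, rfl⟩, rfl⟩, hv⟩ := hv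
    -- The permutation passes from the order of generators in `gorensteinIdeal` to that in
    -- `generatorRow`.
    refine ⟨![u, s, q, p, t], ?_⟩
    rw [Matrix.mulVecLin_apply, generatorRow_mulVec]
    ext i : 1
    fin_cases i
    simp [hv]
    ring
  · rintro ⟨w, rfl⟩
    rw [Matrix.mulVecLin_apply, generatorRow_mulVec, Matrix.cons_val_zero]
    have hmem : ∀ f ∈ ({X 0 ^ a, X 1 ^ b - X 0 ^ α * X 2 ^ γ, X 2 ^ c,
        X 0 ^ (a - α) * X 1 ^ (b - β), X 1 ^ (b - β) * X 2 ^ (c - γ)} :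
          Set (MvPolynomial (Fin 3) K)), f ∈ gorensteinIdeal K a b c α β γ :=
      fun f hf => Ideal.subset_span hf
    refine Ideal.add_mem _ (Ideal.add_mem _ (Ideal.add_mem _ (Ideal.add_mem _ ?_ ?_) ?_) ?_) ?_ <;>
      exact Ideal.mul_mem_right _ _ (hmem _ (by simp))

/-- The last coordinate of a syzygy lies in `(x^(a-α), z^(c-γ))`, so columns 2 and 3 can clear it.
What remains is a syzygy of monomials, solved with regular sequences of variable powers. -/
lemma exact_skewMatrix_generatorRow (hα : 1 ≤ α) (hαa : α ≤ a) (hβb : β ≤ b) (hγc : γ ≤ c) :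
    Function.Exact (skewMatrix K a b c α β γ).mulVecLin
      (generatorRow K a b c α β γ).mulVecLin := by
  obtain ⟨a', rfl⟩ := Nat.exists_eq_add_of_le' hαa
  obtain ⟨b', rfl⟩ := Nat.exists_eq_add_of_le' hβb
  obtain ⟨c', rfl⟩ := Nat.exists_eq_add_of_le' hγc
  intro v
  rw [Matrix.mulVecLin_apply, generatorRow_mulVec]
  simp only [Nat.add_sub_cancel]
  constructor
  · intro hv
    have hv := congrFun hv 0
    simp only [Matrix.cons_val_zero, Pi.zero_apply] at hv
    have hreg : ∀ (n : ℕ) (g : MvPolynomial (Fin 3) K),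
        (X 1 ^ (b' + β)) ^ n * g ∈ Ideal.span {(X 0 : MvPolynomial (Fin 3) K) ^ a', X 2 ^ c'} →
          g ∈ Ideal.span {(X 0 : MvPolynomial (Fin 3) K) ^ a', X 2 ^ c'} := by
      intro n g h
      rw [← pow_mul] at h
      exact mem_span_X_pow_pair_of_X_pow_mul_mem (by decide) (by decide) h
    have hnil : (X 0 ^ α * X 2 ^ γ : MvPolynomial (Fin 3) K) ^ a' ∈
        Ideal.span {(X 0 : MvPolynomial (Fin 3) K) ^ a', X 2 ^ c'} := by
      obtain ⟨k, hk⟩ := Nat.exists_eq_add_of_le (Nat.le_mul_of_pos_left a' hα)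
      rw [mul_pow, ← pow_mul, hk, pow_add, mul_assoc]
      exact Ideal.mul_mem_right _ _ (Ideal.subset_span (by simp))
    have h4 : v 4 ∈ Ideal.span {(X 0 : MvPolynomial (Fin 3) K) ^ a', X 2 ^ c'} := by
      -- The first four generators vanish modulo `(x^a', z^c')`, so the relation kills `v 4` times
      -- the binomial there.
      refine mem_of_sub_mul_mem hreg hnil (Ideal.mem_span_pair.2
        ⟨-(X 0 ^ α * v 1 + X 1 ^ b' * v 3), -(X 2 ^ γ * v 0 + X 1 ^ b' * v 2), ?_⟩)
      linear_combination (-1 : MvPolynomial (Fin 3) K) * hv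
    obtain ⟨s, t, hst⟩ := Ideal.mem_span_pair.1 h4
    -- the coordinates of `v` after subtracting the combination of columns with last entry `v 4`
    have hw : X 2 ^ (c' + γ) * (v 0 - X 0 ^ α * t) + X 0 ^ (a' + α) * (v 1 - X 2 ^ γ * s) =
        X 1 ^ b' * -(X 2 ^ c' * (v 2 + X 1 ^ β * t) + X 0 ^ a' * (v 3 + X 1 ^ β * s)) := by
      rw [← hst] at hv
      linear_combination hv
    have h0 : v 0 - X 0 ^ α * t ∈
        Ideal.span {(X 1 : MvPolynomial (Fin 3) K) ^ b', X 0 ^ (a' + α)} := by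
      refine mem_span_X_pow_pair_of_X_pow_mul_mem (k := 2) (n := c' + γ) (by decide) (by decide)
        (Ideal.mem_span_pair.2 ⟨-(X 2 ^ c' * (v 2 + X 1 ^ β * t) + X 0 ^ a' * (v 3 + X 1 ^ β * s)),
          -(v 1 - X 2 ^ γ * s), ?_⟩)
      linear_combination (-1 : MvPolynomial (Fin 3) K) * hw
    obtain ⟨p, q, hpq⟩ := Ideal.mem_span_pair.1 h0
    obtain ⟨p', -, hp'⟩ := exists_eq_mul_of_X_pow_mul_eq (K := K) (i := (1 : Fin 3)) (j := 0)
      (p := b') (q := a' + α)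
      (f := -(X 2 ^ c' * (v 2 + X 1 ^ β * t) + X 0 ^ a' * (v 3 + X 1 ^ β * s)) - X 2 ^ (c' + γ) * p)
      (g := v 1 - X 2 ^ γ * s + X 2 ^ (c' + γ) * q) (by decide) (by
        rw [← hpq] at hw
        linear_combination (-1 : MvPolynomial (Fin 3) K) * hw)
    have hv1 : v 1 = X 1 ^ b' * p' + X 2 ^ γ * s - X 2 ^ (c' + γ) * q := by
      linear_combination hp'
    have hv0 : v 0 = p * X 1 ^ b' + q * X 0 ^ (a' + α) + X 0 ^ α * t := by
      linear_combination -hpq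
    have hr0 : X 2 ^ (c' + γ) * p + X 0 ^ (a' + α) * p' +
        X 2 ^ c' * (v 2 + X 1 ^ β * t) + X 0 ^ a' * (v 3 + X 1 ^ β * s) = 0 := by
      refine mul_left_cancel₀ (pow_ne_zero b' (X_ne_zero (1 : Fin 3))) ?_
      rw [hv0, hv1] at hw
      linear_combination hw
    obtain ⟨r, hr1, hr2⟩ := exists_eq_mul_of_X_pow_mul_eq (K := K) (i := (2 : Fin 3)) (j := 0)
      (p := c') (q := a') (f := X 2 ^ γ * p + (v 2 + X 1 ^ β * t))
      (g := -(X 0 ^ α * p' + (v 3 + X 1 ^ β * s))) (by decide) (by linear_combination hr0)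
    -- The `q`-terms express the Koszul syzygy of `z^c` and `x^a` as `-z^c'`, `-x^a'`, `-y^β` times
    -- columns 2, 3, 4.
    refine ⟨![-p', p, s - X 2 ^ c' * q, -t - X 0 ^ a' * q,
      -r - X 1 ^ β * q], ?_⟩
    rw [Matrix.mulVecLin_apply, skewMatrix_mulVec]
    simp only [Nat.add_sub_cancel]
    ext i : 1
    fin_cases i
    · simp
      linear_combination -hv0
    · simp
      linear_combination -hv1
    · simp
      linear_combination -hr1
    · simp
      linear_combination hr2
    · simp
      linear_combination hst
  · rintro ⟨w, rfl⟩
    rw [Matrix.mulVecLin_apply, skewMatrix_mulVec]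
    ext i : 1
    fin_cases i
    simp
    ring

lemma exact_generatorRow_transpose_skewMatrix (hαa : α ≤ a) (hβb : β ≤ b) (hγc : γ ≤ c) :
    Function.Exact (generatorRow K a b c α β γ).transpose.mulVecLin
      (skewMatrix K a b c α β γ).mulVecLin := by
  obtain ⟨a', rfl⟩ := Nat.exists_eq_add_of_le' hαa
  obtain ⟨b', rfl⟩ := Nat.exists_eq_add_of_le' hβb
  obtain ⟨c', rfl⟩ := Nat.exists_eq_add_of_le' hγc
  intro v
  rw [Matrix.mulVecLin_apply, skewMatrix_mulVec]
  simp only [Nat.add_sub_cancel]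
  constructor
  · intro hv
    -- Four of the five rows determine `v`: rows 0, 1 and 4 yield the common factor `r`, and row 2
    -- then yields the last coordinate.
    have e0 := congrFun hv 0
    have e1 := congrFun hv 1
    have e2 := congrFun hv 2
    have e4 := congrFun hv 4
    simp at e0 e1 e2 e4
    obtain ⟨s, hs1, hs3⟩ := exists_eq_mul_of_X_pow_mul_eq (by decide) (sub_eq_zero.1 e0)
    obtain ⟨t, ht2, ht0⟩ := exists_eq_mul_of_X_pow_mul_eq (by decide) (sub_eq_zero.1 e1)
    have hst : X 0 ^ a' * t = X 2 ^ c' * s := by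
      refine mul_left_cancel₀ (pow_ne_zero b' (X_ne_zero (1 : Fin 3))) ?_
      rw [ht2, hs3] at e4
      linear_combination e4
    obtain ⟨r, ht, hs⟩ := exists_eq_mul_of_X_pow_mul_eq (by decide) hst
    have h4 : v 4 = (X 1 ^ (b' + β) - X 0 ^ α * X 2 ^ γ) * r := by
      refine mul_left_cancel₀ (pow_ne_zero a' (X_ne_zero (0 : Fin 3))) ?_
      rw [hs3, hs1, hs] at e2
      linear_combination -e2
    refine ⟨fun _ => r, ?_⟩
    rw [Matrix.mulVecLin_apply, generatorRow_transpose_mulVec]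
    simp only [Nat.add_sub_cancel]
    ext i : 1
    fin_cases i
    · simp [ht0, ht]; ring
    · simp [hs1, hs]; ring
    · simp [ht2, ht]; ring
    · simp [hs3, hs]; ring
    · simp [h4]
  · rintro ⟨w, rfl⟩
    rw [Matrix.mulVecLin_apply, generatorRow_transpose_mulVec]
    simp only [Nat.add_sub_cancel]
    ext i : 1
    fin_cases i <;> simp <;> ring

lemma injective_generatorRow_transpose :
    Function.Injective (generatorRow K a b c α β γ).transpose.mulVecLin := by
  rw [injective_iff_map_eq_zero]
  intro v hv
  rw [Matrix.mulVecLin_apply, generatorRow_transpose_mulVec] at hv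
  have h0 := congrFun hv 0
  simp only [Matrix.cons_val_zero, Pi.zero_apply] at h0
  ext i : 1
  fin_cases i
  exact (mul_eq_zero.1 h0).resolve_left (pow_ne_zero _ (X_ne_zero _))

theorem isMinimalGradedFreeResolution_gorensteinIdeal (hα : 1 ≤ α) (hαa : α + 1 ≤ a)
    (hβ : 1 ≤ β) (hβb : β + 1 ≤ b) (hγ : 1 ≤ γ) (hγc : γ + 1 ≤ c) (hb : α + γ = b) :
    IsMinimalGradedFreeResolution (gorensteinIdeal K a b c α β γ)
      ![(c : ℤ), (a : ℤ), (c : ℤ) + α - β, (a : ℤ) + γ - β, (b : ℤ)]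
      ![(a : ℤ) + b - β, (b : ℤ) + c - β, (a : ℤ) + γ, (c : ℤ) + α, (a : ℤ) + c - β]
      (fun _ : Fin 1 => (a : ℤ) + b + c - β)
      (generatorRow K a b c α β γ) (skewMatrix K a b c α β γ)
      (generatorRow K a b c α β γ).transpose where
  map₁ := isMinimalGradedMap_generatorRow hα hαa hβb hγc hb
  map₂ := isMinimalGradedMap_skewMatrix hα hαa hβ hβb hγ hγc hb
  map₃ := isMinimalGradedMap_generatorRow_transpose hα hαa hβb hγc hb
  exact₀ := exact_generatorRow_mkQ
  exact₁ := exact_skewMatrix_generatorRow hα (by omega) (by omega) (by omega)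
  exact₂ := exact_generatorRow_transpose_skewMatrix (by omega) (by omega) (by omega)
  injective := injective_generatorRow_transpose

end Resolution

end GorensteinCodimThree

theorem proposition3p1 {K : Type*} [Field K] [CharZero K] (a b c α β γ : ℕ)
    (hα : 1 ≤ α) (hαa : α + 1 ≤ a) (hβ : 1 ≤ β) (hβb : β + 1 ≤ b)
    (hγ : 1 ≤ γ) (hγc : γ + 1 ≤ c) (hb : α + γ = b) :
    -- (i)
    (GorensteinCodimThree.gorensteinIdeal K a b c α β γ =
        (GorensteinCodimThree.completeIntersection K a b c α γ).colon {X 1 ^ β} ∧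
      GorensteinCodimThree.IsArtinianGorenstein
        (GorensteinCodimThree.gorensteinIdeal K a b c α β γ) ∧
      (GorensteinCodimThree.gorensteinIdeal K a b c α β γ).height = 3 ∧
      GorensteinCodimThree.hilbertFunction
        (GorensteinCodimThree.gorensteinIdeal K a b c α β γ) 1 = 3 ∧
      GorensteinCodimThree.HasSocleDegree
        (GorensteinCodimThree.gorensteinIdeal K a b c α β γ) (a + b + c - β - 3)) ∧
    -- (ii)
    (∃ m : ℕ,
      IsGreatest {j : ℕ | (0 : ℤ) ≤ (a : ℤ) - 1 - j * α ∧ (0 : ℤ) ≤ (c : ℤ) - 1 - j * γ} m ∧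
      GorensteinCodimThree.IsMacaulayDualGenerator
        (GorensteinCodimThree.gorensteinIdeal K a b c α β γ)
        (GorensteinCodimThree.dualGenerator K a b c α β γ m)) ∧
    -- (iii)
    ((GorensteinCodimThree.skewMatrix K a b c α β γ).transpose =
        -GorensteinCodimThree.skewMatrix K a b c α β γ ∧
      GorensteinCodimThree.IsMinimalGradedFreeResolution
        (GorensteinCodimThree.gorensteinIdeal K a b c α β γ)
        ![(c : ℤ), (a : ℤ), (c : ℤ) + α - β, (a : ℤ) + γ - β, (b : ℤ)]
        ![(a : ℤ) + b - β, (b : ℤ) + c - β, (a : ℤ) + γ, (c : ℤ) + α, (a : ℤ) + c - β]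
        (fun _ : Fin 1 => (a : ℤ) + b + c - β)
        (GorensteinCodimThree.generatorRow K a b c α β γ)
        (GorensteinCodimThree.skewMatrix K a b c α β γ)
        (GorensteinCodimThree.generatorRow K a b c α β γ).transpose) := by

  have hI := GorensteinCodimThree.gorensteinIdeal_eq_annihilator (K := K) hαa hγc hβb
  have h1 : (1 : MvPolynomial (Fin 3) K) ∉
      GorensteinCodimThree.gorensteinIdeal K a b c α β γ := by
    intro h1
    have h := GorensteinCodimThree.hilbertFunction_gorensteinIdeal_one
      (K := K) hα hαa hγ hγc hβb hb
    have : Subsingleton (MvPolynomial (Fin 3) K ⧸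
        GorensteinCodimThree.gorensteinIdeal K a b c α β γ) :=
      Ideal.Quotient.subsingleton_iff.2 ((Ideal.eq_top_iff_one _).2 h1)
    rw [GorensteinCodimThree.hilbertFunction, Module.finrank_zero_of_subsingleton] at h
    omega
  have := GorensteinCodimThree.finiteDimensional_quotient_gorensteinIdeal
    (K := K) hαa hγc hβb
  have hL := GorensteinCodimThree.dualFunctional_of_isHomogeneous (K := K) (a := a) (c := c) hb hβb
  have hmem (f : MvPolynomial (Fin 3) K) :
      f ∈ GorensteinCodimThree.gorensteinIdeal K a b c α β γ ↔
        ∀ h, GorensteinCodimThree.dualFunctional K a b c α β γ (h * f) = 0 := by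
    rw [hI, GorensteinCodimThree.mem_functionalAnnihilator]
  obtain ⟨hG, hD⟩ := GorensteinCodimThree.isArtinianGorenstein_of_functional hL hmem h1
  refine ⟨⟨GorensteinCodimThree.gorensteinIdeal_eq_colon hαa hγc hβb, hG, ?_,
    GorensteinCodimThree.hilbertFunction_gorensteinIdeal_one hα hαa hγ hγc hβb hb, hD⟩, ?_,
    GorensteinCodimThree.skewMatrix_transpose,
    GorensteinCodimThree.isMinimalGradedFreeResolution_gorensteinIdeal hα hαa hβ hβb hγ hγc hb⟩
  · refine (GorensteinCodimThree.height_eq_of_X_pow_mem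
      (fun h => h1 ((Ideal.eq_top_iff_one _).1 h)) fun i => ?_).trans (by norm_num)
    -- One more than the socle degree: no complementary degree exists, so the orthogonality
    -- condition is vacuous.
    exact ⟨a + b + c - β - 3 + 1, GorensteinCodimThree.mem_of_isHomogeneous_of_functional hL hmem
      (MvPolynomial.isHomogeneous_X_pow i _) fun j hj => by omega⟩
  · obtain ⟨m, hm⟩ := GorensteinCodimThree.exists_isGreatest_dualGenerator (a := a) (c := c)
      (γ := γ) hα (by omega) (by omega)
    exact ⟨m, hm, GorensteinCodimThree.isMacaulayDualGenerator_dualGenerator hα hαa hγc hβb hm⟩
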